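/- Let $n\ge 2$ and $\alpha\in(0,1)$. Let $g_1,g_2$ be $C^\infty$ Riemannian metrics on $\mathbb{R}^n$ which agree with the Euclidean metric outside a compact set. Let $\Omega\subset\mathbb{R}^n$ be a bounded open set with $C^\infty$ boundary, put $\Omega_e=\mathbb{R}^n\setminus\overline{\Omega}$, and let $W_1,W_2\subset\Omega_e$ be nonempty open sets. For $g\in\{g_1,g_2\}$ let $dV_g=|g|^{1/2}dx$, $|g|=\det(g_{jk})$, and let $-\Delta_g=-|g|^{-1/2}\sum_{j,k}\partial_j\big(|g|^{1/2}g^{jk}\partial_k\,\cdot\,\big)$ be the nonnegative self-adjoint Laplace--Beltrami operator on $L^2(\mathbb{R}^n;dV_g)$ with domain $\{u\in L^2:-\Delta_g u\in L^2\}$. Its fractional powers are defined by the functional calculus. Let $\mathcal{E}_g(u,v)=((-\Delta_g)^{\alpha/2}u,(-\Delta_g)^{\alpha/2}v)_{L^2(dV_g)}$ for $u,v\in H^\alpha(\mathbb{R}^n)$, and extend $(-\Delta_g)^\alpha$ to $H^\alpha(\mathbb{R}^n)\to H^{-\alpha}(\mathbb{R}^n)$ by $\langle(-\Delta_g)^\alpha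 u,\,|g|^{1/2}\overline{v}\rangle=\mathcal{E}_g(u,v)$. For $f\in C_0^\infty(W_1)$ let $u_g^f\in H^\alpha(\mathbb{R}^n)$ be the energy solution of $(-\Delta_g)^\alpha u=0$ in $\Omega$, $u=f$ in $\Omega_e$; that is, $u_g^f-f\in H^\alpha(\mathbb{R}^n)$ is supported in $\overline{\Omega}$ and $\mathcal{E}_g(u_g^f,\varphi)=0$ for all $\varphi\in C_0^\infty(\Omega)$. (It is a known fact that the energy solution exists and is unique.) The partial exterior Dirichlet-to-Neumann map is $$\Lambda_g^{W_1,W_2}:C_0^\infty(W_1)\to H^{-\alpha}(W_2),\qquad f\mapsto\big((-\Delta_g)^\alpha u_g^f\big)\big|_{W_2},$$ where $H^{-\alpha}(W_2)=\{T|_{W_2}:T\in H^{-\alpha}(\mathbb{R}^n)\}$. Suppose that $\Phi:\mathbb{R}^n\to\mathbb{R}^n$ is a $C^\infty$ diffeomorphism such that $g_1=\Phi^*g_2$, i.e. $g_1(x)(t,s)=g_2(\Phi(x))(\Phi'(x)t,\Phi'(x)s)$ for all $x,t,s\in\mathbb{R}^n$, and $\Phi(x)=x$ for all $x\in\Omega_e$.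 Then $$\Lambda_{g_1}^{W_1,W_2}=\Lambda_{g_2}^{W_1,W_2}$$ (equality of maps, i.e. of their graphs). -/

import Mathlib

open MeasureTheory TopologicalSpace
open scoped ContDiff Manifold Distributions SchwartzMap ComplexConjugate

noncomputable section

namespace FracCalderon

/-- The space `ℝⁿ` with its Euclidean norm. -/
abbrev Rn (n : ℕ) : Type := EuclideanSpace ℝ (Fin n)

/-! ### Riemannian metrics and the Laplace-Beltrami operator -/

/-- A `C^∞` Riemannian metric `g = (g_{jk})` on `ℝⁿ`: a matrix-valued function with smooth entries
and symmetric positive definite values (`Matrix.PosDef` includes the symmetry). -/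
structure RiemannianMetric (n : ℕ) where
  /-- the matrix `(g_{jk}(x))` -/
  coeff : Rn n → Matrix (Fin n) (Fin n) ℝ
  smooth : ∀ j k, ContDiff ℝ ∞ fun x => coeff x j k
  posDef : ∀ x, (coeff x).PosDef

namespace RiemannianMetric

variable {n : ℕ}

/-- The inner product `g(x)(t, s) = ∑ g_{jk}(x) t_j s_k` of two tangent vectors at `x`. -/
def form (g : RiemannianMetric n) (x t s : Rn n) : ℝ :=
  ∑ j, ∑ k, g.coeff x j k * t j * s k

/-- The metric agrees with the Euclidean metric outside a compact set. -/
def EuclideanOutsideCompact (g : RiemannianMetric n) : Prop :=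
  ∃ K : Set (Rn n), IsCompact K ∧ ∀ x ∉ K, g.coeff x = 1

/-- The density `|g|^{1/2}`, where `|g| = det (g_{jk})`. -/
def sqrtDet (g : RiemannianMetric n) (x : Rn n) : ℝ := √(g.coeff x).det

/-- The Riemannian volume measure `dV_g = |g|^{1/2} dx`. -/
def vol (g : RiemannianMetric n) : Measure (Rn n) :=
  volume.withDensity fun x => ENNReal.ofReal (g.sqrtDet x)

/-- The Hilbert space `L²(ℝⁿ; dV_g)` of complex-valued functions. -/
abbrev L2 (g : RiemannianMetric n) : Type := Lp ℂ 2 g.vol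

/-- The partial derivative `∂φ/∂x_j`. -/
def partialDeriv (j : Fin n) (φ : Rn n → ℂ) (x : Rn n) : ℂ :=
  fderiv ℝ φ x (EuclideanSpace.single j 1)

/-- `-Δ_g φ = -|g|^{-1/2} ∑_{j,k} ∂_j (|g|^{1/2} g^{jk} ∂_k φ)`, for smooth `φ`. -/
def negLaplacian (g : RiemannianMetric n) (φ : Rn n → ℂ) (x : Rn n) : ℂ :=
  -((g.sqrtDet x : ℂ)⁻¹ * ∑ j, ∑ k, partialDeriv j
    (fun y => (g.sqrtDet y : ℂ) * (((g.coeff y)⁻¹ j k : ℝ) : ℂ) * partialDeriv k φ y) x)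

/-- The graph of the self-adjoint operator `-Δ_g` on `L²(ℝⁿ; dV_g)`, whose domain is
`{u ∈ L² : -Δ_g u ∈ L²}`: the pairs `(u, v)` of elements of `L²(ℝⁿ; dV_g)` such that `-Δ_g u = v`
in the sense of distributions. -/
def laplaceGraph (g : RiemannianMetric n) : Set (g.L2 × g.L2) :=
  {p | ∀ φ : 𝓓((⊤ : Opens (Rn n)), ℂ),
    ∫ x, p.1 x * g.negLaplacian φ x ∂g.vol = ∫ x, p.2 x * φ x ∂g.vol}

end RiemannianMetric

/-! ### Fractional powers of a nonnegative self-adjoint operator -/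

section FunctionalCalculus

variable {H : Type*} [NormedAddCommGroup H] [InnerProductSpace ℂ H]

/-- `B` is the bounded inverse `(1 + A)⁻¹`, where the unbounded operator `A` is given by its graph:
`B` maps into the domain of `A`, with `(1 + A) B f = f`, and `B (1 + A) u = u` on that domain. -/
def IsResolvent (A : Set (H × H)) (B : H →L[ℂ] H) : Prop :=
  (∀ f : H, (B f, f - B f) ∈ A) ∧ ∀ u v : H, (u, v) ∈ A → B (u + v) = u

/-- There is at most one such operator `B`. -/
theorem IsResolvent.unique {A : Set (H × H)} {B B' : H →L[ℂ] H}
    (h : IsResolvent A B) (h' : IsResolvent A B') : B = B' := by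
  ext f
  simpa using h.2 _ _ (h'.1 f)

variable [CompleteSpace H]

/-- The graph of the power `A ^ s`, `s > 0`, of a nonnegative self-adjoint operator `A`, in the
sense of the functional calculus. With `B = (1 + A)⁻¹`, a bounded self-adjoint operator with
spectrum in `[0, 1]`, one has `A = B⁻¹ (1 - B)`, so a spectral parameter `b` of `B` corresponds to
`λ = (1 - b) / b` and `λ ^ s = (1 - b) ^ s / b ^ s`. The domain of `A ^ s` is thus the range of
`B ^ s`, and `A ^ s` maps `B ^ s v` to `(1 - B) ^ s v`. The two powers of the bounded operators
are taken in the continuous functional calculus of `B`. -/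
def powGraph (A : Set (H × H)) (s : ℝ) : Set (H × H) :=
  {p | ∃ B : H →L[ℂ] H, IsResolvent A B ∧ ∃ v : H,
    p.1 = cfc (fun b : ℝ => b ^ s) B v ∧ p.2 = cfc (fun b : ℝ => (1 - b) ^ s) B v}

end FunctionalCalculus

variable {n : ℕ}

/-- `w = (-Δ_g)^s u` in `L²(ℝⁿ; dV_g)`, for functions `u`, `w` determined almost everywhere. This
includes that `u` lies in the domain of `(-Δ_g)^s`. -/
def IsFracLaplacian (g : RiemannianMetric n) (s : ℝ) (u w : Rn n → ℂ) : Prop :=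
  ∃ U W : g.L2, U =ᵐ[g.vol] u ∧ W =ᵐ[g.vol] w ∧ (U, W) ∈ powGraph g.laplaceGraph s

/-- `E_g(u, v) = c`, where `E_g` is the extension to `H^α(ℝⁿ)` of the sesquilinear form
`((-Δ_g)^α u, v)_{L²(dV_g)}`, that is
`E_g(u, v) = ((-Δ_g)^{α/2} u, (-Δ_g)^{α/2} v)_{L²(dV_g)}`. -/
def HasEnergy (g : RiemannianMetric n) (α : ℝ) (u v : Rn n → ℂ) (c : ℂ) : Prop :=
  ∃ p q : Rn n → ℂ, IsFracLaplacian g (α / 2) u p ∧ IsFracLaplacian g (α / 2) v q ∧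
    c = ∫ x, p x * conj (q x) ∂g.vol

/-! ### Sobolev spaces and domains -/

/-- The function `u` (determined almost everywhere) belongs to `H^s(ℝⁿ)`, for `s ≥ 0`. -/
def MemHs (s : ℝ) (u : Rn n → ℂ) : Prop :=
  ∃ U : Lp ℂ 2 (volume : Measure (Rn n)), U =ᵐ[volume] u ∧
    TemperedDistribution.MemSobolev s 2 (U : 𝓢'(Rn n, ℂ))

/-- A test function on an open set, as a complex-valued Schwartz function on `ℝⁿ`. -/
def testToSchwartz {W : Opens (Rn n)} (φ : 𝓓(W, ℝ)) : 𝓢(Rn n, ℂ) :=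
  HasCompactSupport.toSchwartzMap (f := fun x => (φ x : ℂ))
    (φ.hasCompactSupport.comp_left (g := fun r : ℝ => (r : ℂ)) Complex.ofReal_zero)
    (Complex.ofRealCLM.contDiff.comp φ.contDiff)

/-- The space `H^s(W) = {T|_W : T ∈ H^s(ℝⁿ)} ⊆ 𝓓'(W)` on an open set `W`. -/
def sobolevOn (s : ℝ) (W : Opens (Rn n)) : Set 𝓓'(W, ℂ) :=
  {h | ∃ T : 𝓢'(Rn n, ℂ), TemperedDistribution.MemSobolev s 2 T ∧
    ∀ φ : 𝓓(W, ℝ), h φ = T (testToSchwartz φ)}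

/-- The open set `Ω` has `C^∞` boundary: near each boundary point it is the set where a smooth
function with nonvanishing differential at that point is negative. -/
def HasSmoothBoundary (Ω : Opens (Rn n)) : Prop :=
  ∀ p ∈ frontier (Ω : Set (Rn n)), ∃ U : Set (Rn n), IsOpen U ∧ p ∈ U ∧
    ∃ ρ : Rn n → ℝ, ContDiffOn ℝ ∞ ρ U ∧ fderiv ℝ ρ p ≠ 0 ∧
      ∀ x ∈ U, x ∈ Ω ↔ ρ x < 0

/-- The exterior `Ω_e = ℝⁿ \ closure Ω`. -/
def exterior (Ω : Opens (Rn n)) : Set (Rn n) := (closure (Ω : Set (Rn n)))ᶜ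

/-! ### The exterior Dirichlet problem and the Dirichlet-to-Neumann map -/

/-- `u ∈ H^α(ℝⁿ)` is an energy solution of `(-Δ_g)^α u = 0` in `Ω`, `u = f` in `Ω_e`:
`u - f` vanishes in `Ω_e`, i.e. `u - f ∈ H^α_0(Ω)`, and `E_g(u, φ) = 0` for all
`φ ∈ C_0^∞(Ω)`. -/
structure IsEnergySolution (α : ℝ) (g : RiemannianMetric n) (Ω : Opens (Rn n))
    (f u : Rn n → ℂ) : Prop where
  memHs : MemHs α u
  sub_memHs : MemHs α (u - f)
  exterior_eq : ∀ᵐ x ∂(volume : Measure (Rn n)), x ∈ exterior Ω → u x - f x = 0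
  energy_eq : ∀ φ : 𝓓(Ω, ℂ), HasEnergy g α u φ 0

/-- `h` is the restriction to `W` of the distribution `(-Δ_g)^α u`, `u ∈ H^α(ℝⁿ)`. The operator
`(-Δ_g)^α : H^α(ℝⁿ) → H^{-α}(ℝⁿ)` is the extension given by the form `E_g`, that is
`⟨(-Δ_g)^α u, |g|^{1/2} v̄⟩ = E_g(u, v)`; so `⟨(-Δ_g)^α u, φ⟩ = E_g(u, |g|^{-1/2} φ)` for real-valued
test functions `φ`, and these determine a distribution. -/
def IsFracLaplacianRestriction (α : ℝ) (g : RiemannianMetric n) (W : Opens (Rn n))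
    (u : Rn n → ℂ) (h : 𝓓'(W, ℂ)) : Prop :=
  ∀ φ : 𝓓(W, ℝ), HasEnergy g α u (fun x => ((φ x / g.sqrtDet x : ℝ) : ℂ)) (h φ)

/-- The partial exterior Dirichlet-to-Neumann map
`Λ_g^{W₁,W₂} : C_0^∞(W₁) → H^{-α}(W₂)`, `f ↦ ((-Δ_g)^α u^f)|_{W₂}`, where `u^f` is the energy
solution with exterior data `f`; the map is given as its graph. -/
def dnMap (α : ℝ) (g : RiemannianMetric n) (Ω W₁ W₂ : Opens (Rn n)) :
    Set (𝓓(W₁, ℂ) × 𝓓'(W₂, ℂ)) :=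
  {p | p.2 ∈ sobolevOn (-α) W₂ ∧ ∃ u : Rn n → ℂ,
    IsEnergySolution α g Ω p.1 u ∧ IsFracLaplacianRestriction α g W₂ u p.2}

end FracCalderon

end

/-!
The theorem holds because `u ↦ u ∘ Φ` carries the exterior problem for `g₂` to the exterior problem
for `g₁` and changes nothing in the exterior domain. By the symmetry between `Φ` and `Φ⁻¹` one
inclusion of graphs is enough (`FracCalderon.dnMap_subset`). It rests on three facts.

*The energy form is invariant* (`IsPullback.hasEnergy_comp`). Since `Φ` preserves the Riemannian
volume (`IsPullback.measurePreserving`), composition with `Φ` is a unitary map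
`L²(dV_{g₂}) → L²(dV_{g₁})`. It intertwines the Laplace-Beltrami operators: by Green's formula it
suffices to compare the forms `∫ g^{jk} ∂_k φ ∂_j χ dV_g`, where the chain rule applies
(`IsPullback.negLaplacian_comp`). The continuous functional calculus commutes with conjugation by a
unitary map, so the fractional powers are intertwined too (`powGraph_conj`).

*Composition with `Φ` preserves `H^α(ℝⁿ)`* (`memHs_comp`). For `0 < α < 1`, Plancherel's formula for
`u(· + h) - u` shows that an `L²` function is in `H^α` if and only if its Gagliardo seminorm
`∬ |u(x) - u(y)|² |x - y|^{-n-2α} dx dy` is finite (`memSobolev_iff_gagliardo`); the Fourier symbol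
of this seminorm is a positive multiple of `|ξ|^{2α}` by homogeneity and rotation invariance
(`exists_gagliardoSymbol_eq`). The seminorm is controlled under Lipschitz changes of variables with
bounded volume distortion, and `Φ` is one, as it differs from the identity on a bounded set only.

*`Φ` maps `Ω` into `Ω`* (`map_mem_domain`), as a domain with smooth boundary is the interior of its
closure. Hence `φ ↦ φ ∘ Φ⁻¹` preserves the test functions on `Ω`. Exterior data supported in `W₁`,
test functions supported in `W₂`, and the density `|g|^{1/2}` on the exterior domain are unchanged,
because `Φ` is the identity there.
-/

namespace FracCalderon

/-! ### Fractional powers under unitary maps -/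

section Unitary

variable {H K : Type*} [NormedAddCommGroup H] [InnerProductSpace ℂ H] [CompleteSpace H]
  [NormedAddCommGroup K] [InnerProductSpace ℂ K] [CompleteSpace K]

/-- Conjugation by a unitary map commutes with the continuous functional calculus. Self-adjointness
is not assumed: if it fails, then both sides are `0` by convention. -/
theorem conjStarAlgEquiv_cfc (e : H ≃ₗᵢ[ℂ] K) (f : ℝ → ℝ) (hf : Continuous f) (B : H →L[ℂ] H) :
    e.conjStarAlgEquiv (cfc f B) = cfc f (e.conjStarAlgEquiv B) := by
  have hiff : IsSelfAdjoint (e.conjStarAlgEquiv B) ↔ IsSelfAdjoint B := by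
    simp only [IsSelfAdjoint, ← map_star, EmbeddingLike.apply_eq_iff_eq]
  by_cases hB : IsSelfAdjoint B
  · have hc : Continuous e.conjStarAlgEquiv := by
      have : (e.conjStarAlgEquiv : (H →L[ℂ] H) → (K →L[ℂ] K)) =
          fun x => (e : H →L[ℂ] K) ∘L x ∘L (e.symm : K →L[ℂ] H) := rfl
      rw [this]
      fun_prop
    exact StarAlgHomClass.map_cfc (S := ℂ) e.conjStarAlgEquiv f B hf.continuousOn hc hB
      (hiff.2 hB)
  · rw [cfc_apply_of_not_predicate _ hB, cfc_apply_of_not_predicate _ (fun h => hB (hiff.1 h)),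
      map_zero]

theorem IsResolvent.conj (e : H ≃ₗᵢ[ℂ] K) {A : Set (H × H)} {A' : Set (K × K)}
    (hA : ∀ u v, (u, v) ∈ A ↔ (e u, e v) ∈ A') {B : H →L[ℂ] H} (hB : IsResolvent A B) :
    IsResolvent A' (e.conjStarAlgEquiv B) := by
  refine ⟨fun f => ?_, fun u v huv => ?_⟩
  · have := (hA _ _).1 (hB.1 (e.symm f))
    simpa using this
  · have h := hB.2 (e.symm u) (e.symm v) ((hA _ _).2 (by simpa using huv))
    rw [LinearIsometryEquiv.conjStarAlgEquiv_apply_apply, map_add, h, e.apply_symm_apply]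

/-- A unitary map that carries the graph of `A` onto the graph of `A'` carries the graph of
`A ^ s` into the graph of `A' ^ s`. -/
theorem powGraph_conj (e : H ≃ₗᵢ[ℂ] K) {A : Set (H × H)} {A' : Set (K × K)}
    (hA : ∀ u v, (u, v) ∈ A ↔ (e u, e v) ∈ A') {s : ℝ} (hs : 0 ≤ s) {u v : H}
    (h : (u, v) ∈ powGraph A s) : (e u, e v) ∈ powGraph A' s := by
  obtain ⟨B, hB, w, h1, h2⟩ := h
  refine ⟨e.conjStarAlgEquiv B, hB.conj e hA, e w, ?_, ?_⟩
  · rw [← conjStarAlgEquiv_cfc e _ (Real.continuous_rpow_const hs)]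
    simpa using h1
  · have hc : Continuous fun b : ℝ => (1 - b) ^ s :=
      (Real.continuous_rpow_const hs).comp (continuous_const.sub continuous_id)
    rw [← conjStarAlgEquiv_cfc e _ hc]
    simpa using h2

end Unitary

/-! ### Smoothness of the density and of the inverse metric -/

variable {n : ℕ}

theorem contDiff_matrix_det {f : Rn n → Matrix (Fin n) (Fin n) ℝ}
    (hf : ∀ j k, ContDiff ℝ ∞ fun x => f x j k) : ContDiff ℝ ∞ fun x => (f x).det := by
  simp only [Matrix.det_apply]
  refine ContDiff.sum fun σ _ => ContDiff.const_smul _ ?_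
  exact contDiff_prod fun i _ => hf _ _

namespace RiemannianMetric

variable (g : RiemannianMetric n)

theorem det_pos (x : Rn n) : 0 < (g.coeff x).det := (g.posDef x).det_pos

theorem sqrtDet_pos (x : Rn n) : 0 < g.sqrtDet x := Real.sqrt_pos.2 (g.det_pos x)

theorem contDiff_sqrtDet : ContDiff ℝ ∞ g.sqrtDet :=
  (contDiff_matrix_det g.smooth).sqrt fun x => (g.det_pos x).ne'

theorem contDiff_inv_coeff (j k : Fin n) : ContDiff ℝ ∞ fun x => (g.coeff x)⁻¹ j k := by
  simp only [Matrix.inv_def, Matrix.smul_apply, Matrix.adjugate_apply, Ring.inverse_eq_inv',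
    smul_eq_mul]
  refine ((contDiff_matrix_det g.smooth).inv fun x => (g.det_pos x).ne').mul
    (contDiff_matrix_det fun i l => ?_)
  by_cases h : i = k
  · subst h
    simp only [Matrix.updateRow_self]
    exact contDiff_const
  · simp only [Matrix.updateRow_ne h]
    exact g.smooth i l

theorem isLocallyFiniteMeasure_vol : IsLocallyFiniteMeasure g.vol :=
  IsLocallyFiniteMeasure.withDensity_ofReal g.contDiff_sqrtDet.continuous

theorem integral_vol (f : Rn n → ℂ) : ∫ x, f x ∂g.vol = ∫ x, (g.sqrtDet x : ℂ) * f x := by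
  rw [vol, integral_withDensity_eq_integral_toReal_smul
    g.contDiff_sqrtDet.continuous.measurable.ennreal_ofReal (by simp)]
  refine integral_congr_ae (Filter.Eventually.of_forall fun x => ?_)
  simp [ENNReal.toReal_ofReal (g.sqrtDet_pos x).le]

end RiemannianMetric

/-! ### Isometries -/

/-- Smooth diffeomorphisms of `ℝⁿ`. -/
abbrev Diffeo (n : ℕ) : Type := Rn n ≃ₘ⟮𝓘(ℝ, Rn n), 𝓘(ℝ, Rn n)⟯ Rn n

/-- `g₁ = Φ^* g₂`: the diffeomorphism `Φ` is an isometry from `(ℝⁿ, g₁)` to `(ℝⁿ, g₂)`. -/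
def IsPullback (g₁ g₂ : RiemannianMetric n) (Φ : Diffeo n) : Prop :=
  ∀ x t s : Rn n, g₁.form x t s = g₂.form (Φ x) (fderiv ℝ Φ x t) (fderiv ℝ Φ x s)

namespace Diffeo

variable (Φ : Diffeo n)

theorem hasFDerivAt (x : Rn n) : HasFDerivAt Φ (fderiv ℝ Φ x) x :=
  (Φ.contDiff.differentiable (by simp) x).hasFDerivAt

theorem fderiv_symm_fderiv (x t : Rn n) : fderiv ℝ Φ.symm (Φ x) (fderiv ℝ Φ x t) = t := by
  have h := ((hasFDerivAt Φ.symm (Φ x)).comp x (hasFDerivAt Φ x)).fderiv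
  have h2 : (Φ.symm : Rn n → Rn n) ∘ Φ = id := by ext1 x; simp
  rw [h2, fderiv_id] at h
  exact (congrArg (fun L : Rn n →L[ℝ] Rn n => L t) h).symm

theorem fderiv_fderiv_symm (x t : Rn n) : fderiv ℝ Φ (Φ.symm x) (fderiv ℝ Φ.symm x t) = t := by
  have h := fderiv_symm_fderiv Φ.symm x t
  exact h

/-- The Jacobian matrix `(∂Φ_i/∂x_j)`. -/
noncomputable def jac (x : Rn n) : Matrix (Fin n) (Fin n) ℝ :=
  Matrix.of fun i j => fderiv ℝ Φ x (EuclideanSpace.single j 1) i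

theorem det_jac (x : Rn n) : (jac Φ x).det = (fderiv ℝ Φ x).det := by
  rw [ContinuousLinearMap.det, ← LinearMap.det_toMatrix (EuclideanSpace.basisFun (Fin n) ℝ).toBasis]
  congr 1

end Diffeo

open RiemannianMetric

theorem form_single (g : RiemannianMetric n) (x : Rn n) (j k : Fin n) :
    g.form x (EuclideanSpace.single j 1) (EuclideanSpace.single k 1) = g.coeff x j k := by
  simp [form, Finset.sum_ite_eq']

namespace IsPullback

variable {g₁ g₂ : RiemannianMetric n} {Φ : Diffeo n} (h : IsPullback g₁ g₂ Φ)
include h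

theorem symm : IsPullback g₂ g₁ Φ.symm := fun x t s => by
  rw [h]
  simp [Diffeo.fderiv_fderiv_symm]

theorem coeff_eq (x : Rn n) :
    g₁.coeff x = (Φ.jac x).transpose * g₂.coeff (Φ x) * Φ.jac x := by
  ext j k
  rw [← form_single, h, form]
  simp only [Matrix.mul_apply, Matrix.transpose_apply, Finset.sum_mul]
  rw [Finset.sum_comm]
  refine Finset.sum_congr rfl fun a _ => Finset.sum_congr rfl fun b _ => ?_
  simp only [Diffeo.jac, Matrix.of_apply]
  ring

theorem sqrtDet_eq (x : Rn n) :
    g₁.sqrtDet x = |(fderiv ℝ Φ x).det| * g₂.sqrtDet (Φ x) := by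
  rw [sqrtDet, h.coeff_eq, Matrix.det_mul, Matrix.det_mul, Matrix.det_transpose, Diffeo.det_jac,
    sqrtDet, ← Real.sqrt_sq_eq_abs, ← Real.sqrt_mul (sq_nonneg _)]
  congr 1
  ring

theorem isUnit_det_jac (x : Rn n) : IsUnit (Φ.jac x).det := by
  have h1 := g₁.det_pos x
  rw [h.coeff_eq, Matrix.det_mul] at h1
  exact isUnit_iff_ne_zero.2 (right_ne_zero_of_mul h1.ne')

/-- The inverse metric transforms contravariantly: `J g₁⁻¹ Jᵀ = g₂⁻¹ ∘ Φ`. -/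
theorem jac_mul_inv_coeff_mul (x : Rn n) :
    Φ.jac x * (g₁.coeff x)⁻¹ * (Φ.jac x).transpose = (g₂.coeff (Φ x))⁻¹ := by
  have hu := h.isUnit_det_jac x
  have hu' : IsUnit (Φ.jac x).transpose.det := by rwa [Matrix.det_transpose]
  rw [h.coeff_eq, Matrix.mul_inv_rev, Matrix.mul_inv_rev, Matrix.mul_assoc, Matrix.mul_assoc,
    Matrix.mul_assoc, Matrix.nonsing_inv_mul _ hu', Matrix.mul_one, ← Matrix.mul_assoc,
    Matrix.mul_nonsing_inv _ hu, Matrix.one_mul]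

/-- An isometry preserves the Riemannian volume. -/
theorem measurePreserving : MeasurePreserving Φ g₁.vol g₂.vol := by
  have hm : Measurable Φ := Φ.contDiff.continuous.measurable
  refine ⟨hm, ?_⟩
  ext s hs
  have himg : Φ '' (Φ ⁻¹' s) = s := Set.image_preimage_eq s Φ.surjective
  rw [Measure.map_apply hm hs, vol, vol, withDensity_apply _ hs, withDensity_apply _ (hm hs)]
  conv_rhs => rw [← himg]
  rw [lintegral_image_eq_lintegral_abs_det_fderiv_mul volume (hm hs)
    (fun x _ => (Diffeo.hasFDerivAt Φ x).hasFDerivWithinAt) Φ.injective.injOn]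
  refine lintegral_congr fun x => ?_
  rw [h.sqrtDet_eq, ENNReal.ofReal_mul (abs_nonneg _)]

end IsPullback

/-! ### Invariance of the Laplace-Beltrami operator -/

theorem partialDeriv_comp {φ : Rn n → ℂ} (hφ : ContDiff ℝ ∞ φ) (Φ : Diffeo n) (x : Rn n)
    (j : Fin n) : partialDeriv j (φ ∘ Φ) x = ∑ i, (Φ.jac x i j : ℂ) * partialDeriv i φ (Φ x) := by
  have hd := ((hφ.differentiable (by simp) (Φ x)).hasFDerivAt.comp x
    (Diffeo.hasFDerivAt Φ x)).fderiv
  rw [partialDeriv, hd, ContinuousLinearMap.comp_apply]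
  conv_lhs => rw [← (EuclideanSpace.basisFun (Fin n) ℝ).sum_repr
    (fderiv ℝ Φ x (EuclideanSpace.single j 1))]
  simp [map_sum, partialDeriv, Diffeo.jac]

theorem contDiff_partialDeriv {φ : Rn n → ℂ} (hφ : ContDiff ℝ ∞ φ) (j : Fin n) :
    ContDiff ℝ ∞ (partialDeriv j φ) :=
  (hφ.fderiv_right (m := ∞) (by simp)).clm_apply contDiff_const

/-- The pairing `g^{jk} ∂_k φ ∂_j χ` of the gradients of two functions, bilinear (without complex
conjugation). -/
noncomputable def gradForm (g : RiemannianMetric n) (φ χ : Rn n → ℂ) (x : Rn n) : ℂ :=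
  ∑ j, ∑ k, (((g.coeff x)⁻¹ j k : ℝ) : ℂ) * partialDeriv k φ x * partialDeriv j χ x

theorem gradForm_eq_dotProduct (g : RiemannianMetric n) (φ χ : Rn n → ℂ) (x : Rn n) :
    gradForm g φ χ x = (fun j => partialDeriv j χ x) ⬝ᵥ
      (((g.coeff x)⁻¹).map (algebraMap ℝ ℂ)).mulVec fun k => partialDeriv k φ x := by
  simp only [gradForm, dotProduct, Matrix.mulVec, Matrix.map_apply, Finset.mul_sum,
    Complex.coe_algebraMap]
  refine Finset.sum_congr rfl fun j _ => Finset.sum_congr rfl fun k _ => ?_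
  ring

theorem gradForm_comp {g₁ g₂ : RiemannianMetric n} {Φ : Diffeo n} (h : IsPullback g₁ g₂ Φ)
    {φ χ : Rn n → ℂ} (hφ : ContDiff ℝ ∞ φ) (hχ : ContDiff ℝ ∞ χ) (x : Rn n) :
    gradForm g₁ (φ ∘ Φ) (χ ∘ Φ) x = gradForm g₂ φ χ (Φ x) := by
  rw [gradForm_eq_dotProduct, gradForm_eq_dotProduct, ← h.jac_mul_inv_coeff_mul]
  have key : ∀ ψ : Rn n → ℂ, ContDiff ℝ ∞ ψ → (fun j => partialDeriv j (ψ ∘ Φ) x) =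
      ((Φ.jac x).map (algebraMap ℝ ℂ)).transpose.mulVec fun i => partialDeriv i ψ (Φ x) :=
    fun ψ hψ => by
      ext j
      simp [partialDeriv_comp hψ, Matrix.mulVec, dotProduct]
  rw [key φ hφ, key χ hχ, Matrix.map_mul, Matrix.map_mul, Matrix.transpose_map,
    ← Matrix.mulVec_mulVec, ← Matrix.mulVec_mulVec,
    Matrix.dotProduct_mulVec _ (Matrix.map (Φ.jac x) _),
    Matrix.mulVec_transpose, Matrix.mulVec_transpose]

theorem contDiff_flux (g : RiemannianMetric n) {φ : Rn n → ℂ} (hφ : ContDiff ℝ ∞ φ)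
    (j k : Fin n) : ContDiff ℝ ∞ fun y =>
      (g.sqrtDet y : ℂ) * (((g.coeff y)⁻¹ j k : ℝ) : ℂ) * partialDeriv k φ y :=
  ((Complex.ofRealCLM.contDiff.comp g.contDiff_sqrtDet).mul
    (Complex.ofRealCLM.contDiff.comp (g.contDiff_inv_coeff j k))).mul (contDiff_partialDeriv hφ k)

theorem contDiff_negLaplacian (g : RiemannianMetric n) {φ : Rn n → ℂ} (hφ : ContDiff ℝ ∞ φ) :
    ContDiff ℝ ∞ (g.negLaplacian φ) := by
  refine ContDiff.neg (ContDiff.mul ?_ (ContDiff.sum fun j _ => ContDiff.sum fun k _ =>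
    contDiff_partialDeriv (contDiff_flux g hφ j k) j))
  simp only [← Complex.ofReal_inv]
  exact Complex.ofRealCLM.contDiff.comp (g.contDiff_sqrtDet.inv fun x => (g.sqrtDet_pos x).ne')

theorem integral_partialDeriv_mul {f χ : Rn n → ℂ} (hf : ContDiff ℝ ∞ f) (hχ : ContDiff ℝ ∞ χ)
    (hc : HasCompactSupport χ) (j : Fin n) :
    ∫ x, partialDeriv j f x * χ x = -∫ x, f x * partialDeriv j χ x := by
  have hc' : HasCompactSupport (partialDeriv j χ) :=
    hc.fderiv_apply (𝕜 := ℝ) (EuclideanSpace.single j 1)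
  have h := integral_mul_fderiv_eq_neg_fderiv_mul_of_integrable (μ := volume) (f := f) (g := χ)
    (v := EuclideanSpace.single j 1)
    (((contDiff_partialDeriv hf j).continuous.mul hχ.continuous).integrable_of_hasCompactSupport
      hc.mul_left)
    ((hf.continuous.mul (contDiff_partialDeriv hχ j).continuous).integrable_of_hasCompactSupport
      hc'.mul_left)
    ((hf.continuous.mul hχ.continuous).integrable_of_hasCompactSupport hc.mul_left)
    (fun x _ => hf.differentiable (by simp) x) (fun x _ => hχ.differentiable (by simp) x)
  simp only [partialDeriv]
  rw [h, neg_neg]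

/-- Green's formula `(-Δ_g φ, χ) = ∫ g^{jk} ∂_k φ ∂_j χ dV_g`. Its right-hand side involves first
derivatives only, so its behaviour under isometries follows from the chain rule. -/
theorem integral_negLaplacian_mul (g : RiemannianMetric n) {φ χ : Rn n → ℂ}
    (hφ : ContDiff ℝ ∞ φ) (hχ : ContDiff ℝ ∞ χ) (hc : HasCompactSupport χ) :
    ∫ x, g.negLaplacian φ x * χ x ∂g.vol = ∫ x, gradForm g φ χ x ∂g.vol := by
  rw [integral_vol, integral_vol]
  have hc' : ∀ j, HasCompactSupport (partialDeriv j χ) := fun j =>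
    hc.fderiv_apply (𝕜 := ℝ) (EuclideanSpace.single j 1)
  have h1 : ∀ x, (g.sqrtDet x : ℂ) * (g.negLaplacian φ x * χ x) = ∑ j, ∑ k, -(partialDeriv j
      (fun y => (g.sqrtDet y : ℂ) * (((g.coeff y)⁻¹ j k : ℝ) : ℂ) * partialDeriv k φ y) x
        * χ x) := fun x => by
    have : (g.sqrtDet x : ℂ) ≠ 0 := by exact_mod_cast (g.sqrtDet_pos x).ne'
    rw [negLaplacian]
    field_simp
    simp only [Finset.mul_sum, Finset.sum_neg_distrib, mul_comm]
  have h2 : ∀ x, (g.sqrtDet x : ℂ) * gradForm g φ χ x = ∑ j, ∑ k,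
      ((g.sqrtDet x : ℂ) * (((g.coeff x)⁻¹ j k : ℝ) : ℂ) * partialDeriv k φ x)
        * partialDeriv j χ x := fun x => by
    simp only [gradForm, Finset.mul_sum, mul_assoc]
  simp only [h1, h2]
  have i1 : ∀ j k, Integrable fun x => -(partialDeriv j
      (fun y => (g.sqrtDet y : ℂ) * (((g.coeff y)⁻¹ j k : ℝ) : ℂ) * partialDeriv k φ y) x
        * χ x) := fun j k =>
    (((contDiff_partialDeriv (contDiff_flux g hφ j k) j).continuous.mul
      hχ.continuous).integrable_of_hasCompactSupport hc.mul_left).neg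
  have i2 : ∀ j k, Integrable fun x =>
      ((g.sqrtDet x : ℂ) * (((g.coeff x)⁻¹ j k : ℝ) : ℂ) * partialDeriv k φ x)
        * partialDeriv j χ x := fun j k =>
    ((contDiff_flux g hφ j k).continuous.mul
      (contDiff_partialDeriv hχ j).continuous).integrable_of_hasCompactSupport (hc' j).mul_left
  rw [integral_finsetSum _ fun j _ => integrable_finsetSum _ fun k _ => i1 j k,
    integral_finsetSum _ fun j _ => integrable_finsetSum _ fun k _ => i2 j k]
  refine Finset.sum_congr rfl fun j _ => ?_
  rw [integral_finsetSum _ fun k _ => i1 j k, integral_finsetSum _ fun k _ => i2 j k]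
  refine Finset.sum_congr rfl fun k _ => ?_
  rw [integral_neg, integral_partialDeriv_mul (contDiff_flux g hφ j k) hχ hc, neg_neg]

namespace IsPullback

variable {g₁ g₂ : RiemannianMetric n} {Φ : Diffeo n} (h : IsPullback g₁ g₂ Φ)
include h

theorem integral_comp (f : Rn n → ℂ) : ∫ x, f (Φ x) ∂g₁.vol = ∫ x, f x ∂g₂.vol :=
  h.measurePreserving.integral_comp Φ.toHomeomorph.measurableEmbedding f

/-- The Laplace-Beltrami operator is invariant under isometries. Green's formula, applied for both
metrics, shows that the two sides have the same integral against every test function; this avoids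
the second derivatives of `Φ`. -/
theorem negLaplacian_comp {φ : Rn n → ℂ} (hφ : ContDiff ℝ ∞ φ) :
    g₁.negLaplacian (φ ∘ Φ) =ᵐ[g₁.vol] g₂.negLaplacian φ ∘ Φ := by
  have hl := g₁.isLocallyFiniteMeasure_vol
  refine ae_eq_of_integral_contDiff_smul_eq
    (contDiff_negLaplacian g₁ (hφ.comp Φ.contDiff)).continuous.locallyIntegrable
    ((contDiff_negLaplacian g₂ hφ).continuous.comp Φ.contDiff.continuous).locallyIntegrable
    fun χ hχ hc => ?_
  let χ' : Rn n → ℂ := fun x => (χ x : ℂ)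
  have hχ' : ContDiff ℝ ∞ χ' := Complex.ofRealCLM.contDiff.comp hχ
  have hc' : HasCompactSupport χ' := hc.comp_left (g := fun r : ℝ => (r : ℂ)) Complex.ofReal_zero
  -- `χ` is the pullback of the test function `ψ`
  let ψ : Rn n → ℂ := χ' ∘ Φ.symm
  have hψ : ContDiff ℝ ∞ ψ := hχ'.comp Φ.symm.contDiff
  have hψc : HasCompactSupport ψ := hc'.comp_homeomorph Φ.symm.toHomeomorph
  have hψΦ : ψ ∘ Φ = χ' := by ext x; simp [ψ]
  calc ∫ x, χ x • g₁.negLaplacian (φ ∘ Φ) x ∂g₁.vol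
      = ∫ x, g₁.negLaplacian (φ ∘ Φ) x * (ψ ∘ Φ) x ∂g₁.vol := by
        rw [hψΦ]; simp only [Complex.real_smul, χ', mul_comm]
    _ = ∫ x, gradForm g₁ (φ ∘ Φ) (ψ ∘ Φ) x ∂g₁.vol :=
        integral_negLaplacian_mul g₁ (hφ.comp Φ.contDiff) (hψ.comp Φ.contDiff) (hψΦ ▸ hc')
    _ = ∫ x, gradForm g₂ φ ψ (Φ x) ∂g₁.vol := by simp only [gradForm_comp h hφ hψ]
    _ = ∫ x, g₂.negLaplacian φ x * ψ x ∂g₂.vol := by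
        rw [h.integral_comp, integral_negLaplacian_mul g₂ hφ hψ hψc]
    _ = ∫ x, g₂.negLaplacian φ (Φ x) * ψ (Φ x) ∂g₁.vol :=
        (h.integral_comp fun x => g₂.negLaplacian φ x * ψ x).symm
    _ = ∫ x, χ x • (g₂.negLaplacian φ ∘ Φ) x ∂g₁.vol := by
        refine integral_congr_ae (Filter.Eventually.of_forall fun x => ?_)
        simp [ψ, χ', mul_comm]

/-- The composition with an isometry, as a unitary map between the `L²` spaces. -/
noncomputable def unitary : g₂.L2 ≃ₗᵢ[ℂ] g₁.L2 :=
  LinearIsometryEquiv.ofSurjective (Lp.compMeasurePreservingₗᵢ ℂ Φ h.measurePreserving) fun f =>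
    ⟨Lp.compMeasurePreserving Φ.symm h.symm.measurePreserving f, by
      change Lp.compMeasurePreserving Φ h.measurePreserving _ = f
      refine Lp.ext ?_
      refine (Lp.coeFn_compMeasurePreserving _ h.measurePreserving).trans ?_
      have h1 := h.measurePreserving.quasiMeasurePreserving.ae_eq_comp
        (Lp.coeFn_compMeasurePreserving f h.symm.measurePreserving)
      refine h1.trans (Filter.Eventually.of_forall fun x => ?_)
      simp⟩

theorem coeFn_unitary (u : g₂.L2) : h.unitary u =ᵐ[g₁.vol] u ∘ Φ :=
  Lp.coeFn_compMeasurePreserving u h.measurePreserving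

end IsPullback

/-! ### Invariance of the energy form -/

/-- The composition `φ ∘ Ψ` of a test function with a diffeomorphism that maps the complement of
`Ω` into itself. -/
noncomputable def testComp {F : Type*} [NormedAddCommGroup F] [NormedSpace ℝ F]
    {Ω : Opens (Rn n)} (Ψ : Diffeo n)
    (hΨ : ∀ x, Ψ x ∈ Ω → x ∈ Ω) (φ : 𝓓(Ω, F)) : 𝓓(Ω, F) where
  toFun := φ ∘ Ψ
  contDiff' := φ.contDiff.comp Ψ.contDiff
  hasCompactSupport' := φ.hasCompactSupport.comp_homeomorph Ψ.toHomeomorph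
  tsupport_subset' := fun x hx => hΨ x (φ.tsupport_subset
    (tsupport_comp_subset_preimage φ Ψ.contDiff.continuous hx))

namespace IsPullback

variable {g₁ g₂ : RiemannianMetric n} {Φ : Diffeo n} (h : IsPullback g₁ g₂ Φ)
include h

theorem laplaceGraph_unitary {u v : g₂.L2} (huv : (u, v) ∈ g₂.laplaceGraph) :
    (h.unitary u, h.unitary v) ∈ g₁.laplaceGraph := fun φ => by
  let ψ : 𝓓((⊤ : Opens (Rn n)), ℂ) := testComp Φ.symm (fun _ _ => trivial) φ
  have hψ : (ψ : Rn n → ℂ) ∘ Φ = φ := by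
    ext x
    change φ (Φ.symm (Φ x)) = φ x
    simp
  have key := huv ψ
  dsimp only at key ⊢
  rw [← h.integral_comp, ← h.integral_comp (fun x => v x * ψ x)] at key
  convert key using 1
  · refine integral_congr_ae ?_
    have hl := h.negLaplacian_comp ψ.contDiff
    rw [hψ] at hl
    filter_upwards [h.coeFn_unitary u, hl] with x hx hx'
    rw [hx, hx']
    rfl
  · refine integral_congr_ae ?_
    filter_upwards [h.coeFn_unitary v] with x hx
    rw [hx, ← hψ]
    rfl

/-- The unitary map `u ↦ u ∘ Φ` intertwines the two Laplace-Beltrami operators. -/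
theorem laplaceGraph_unitary_iff (u v : g₂.L2) :
    (u, v) ∈ g₂.laplaceGraph ↔ (h.unitary u, h.unitary v) ∈ g₁.laplaceGraph := by
  refine ⟨h.laplaceGraph_unitary, fun huv => ?_⟩
  have hinv : ∀ w : g₂.L2, h.symm.unitary (h.unitary w) = w := fun w => by
    refine Lp.ext ((h.symm.coeFn_unitary _).trans ?_)
    refine (h.symm.measurePreserving.quasiMeasurePreserving.ae_eq_comp
      (h.coeFn_unitary w)).trans (Filter.Eventually.of_forall fun x => ?_)
    simp
  simpa only [hinv] using h.symm.laplaceGraph_unitary huv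

theorem isFracLaplacian_comp {s : ℝ} (hs : 0 ≤ s) {u w : Rn n → ℂ}
    (huw : IsFracLaplacian g₂ s u w) : IsFracLaplacian g₁ s (u ∘ Φ) (w ∘ Φ) := by
  obtain ⟨U, W, hU, hW, hp⟩ := huw
  have hq := h.measurePreserving.quasiMeasurePreserving
  exact ⟨h.unitary U, h.unitary W, (h.coeFn_unitary U).trans (hq.ae_eq_comp hU),
    (h.coeFn_unitary W).trans (hq.ae_eq_comp hW),
    powGraph_conj h.unitary h.laplaceGraph_unitary_iff hs hp⟩

/-- The energy form is invariant under isometries. -/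
theorem hasEnergy_comp {α : ℝ} (hα : 0 ≤ α) {u v : Rn n → ℂ} {c : ℂ}
    (huv : HasEnergy g₂ α u v c) : HasEnergy g₁ α (u ∘ Φ) (v ∘ Φ) c := by
  obtain ⟨p, q, hp, hq, rfl⟩ := huv
  exact ⟨p ∘ Φ, q ∘ Φ, h.isFracLaplacian_comp (by positivity) hp,
    h.isFracLaplacian_comp (by positivity) hq,
    (h.integral_comp fun x => p x * conj (q x)).symm⟩

end IsPullback

/-! ### The Gagliardo seminorm -/

section Gagliardo

open FourierTransform
open scoped ENNReal

variable {V : Type*} [NormedAddCommGroup V] [InnerProductSpace ℝ V]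

/-- The character `ξ ↦ e^{2πi⟨h, ξ⟩}`. -/
noncomputable def phase (h ξ : V) : ℂ := (Real.fourierChar (inner ℝ h ξ) : ℂ)

theorem continuous_phase : Continuous fun p : V × V => phase p.1 p.2 := by
  unfold phase
  fun_prop

theorem norm_phase (h ξ : V) : ‖phase h ξ‖ = 1 := Circle.norm_coe _

theorem phase_zero_right (h : V) : phase h 0 = 1 := by simp [phase]

theorem norm_phase_sub_one_le (h ξ : V) : ‖phase h ξ - 1‖ ≤ 2 * Real.pi * (‖h‖ * ‖ξ‖) := by
  have h1 : phase h ξ = Complex.exp (Complex.I * ((2 * Real.pi * inner ℝ h ξ : ℝ) : ℂ)) := by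
    rw [phase, Real.fourierChar_apply, mul_comm]
  rw [h1]
  refine (Real.norm_exp_I_mul_ofReal_sub_one_le).trans ?_
  rw [Real.norm_eq_abs, abs_mul, abs_of_pos Real.two_pi_pos]
  exact mul_le_mul_of_nonneg_left (abs_real_inner_le_norm h ξ) Real.two_pi_pos.le

theorem norm_phase_sub_one_le_two (h ξ : V) : ‖phase h ξ - 1‖ ≤ 2 := by
  refine (norm_sub_le _ _).trans ?_
  rw [norm_phase, norm_one]
  norm_num

variable [FiniteDimensional ℝ V] [MeasurableSpace V] [BorelSpace V]

theorem lintegral_enorm_sq (U : Lp ℂ 2 (volume : Measure V)) :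
    ∫⁻ x, ‖U x‖ₑ ^ 2 = ‖U‖ₑ ^ 2 := by
  rw [Lp.enorm_def, eLpNorm_eq_lintegral_rpow_enorm_toReal (by simp) (by simp),
    ← ENNReal.rpow_natCast, ← ENNReal.rpow_mul]
  simp

theorem lintegral_enorm_fourier_sq (U : Lp ℂ 2 (volume : Measure V)) :
    ∫⁻ ξ, ‖(𝓕 U : Lp ℂ 2 (volume : Measure V)) ξ‖ₑ ^ 2 = ∫⁻ x, ‖U x‖ₑ ^ 2 := by
  rw [lintegral_enorm_sq, lintegral_enorm_sq, ← ofReal_norm, Lp.norm_fourier_eq, ofReal_norm]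

theorem memLp_phase (h : V) : MemLp (phase h) ∞ (volume : Measure V) :=
  memLp_top_of_bound (continuous_phase.comp (Continuous.prodMk_right h)).aestronglyMeasurable 1
    (Filter.Eventually.of_forall fun ξ => (norm_phase h ξ).le)

/-- The translate `x ↦ U (x + h)` of an `L²` function. -/
noncomputable def translate (h : V) (U : Lp ℂ 2 (volume : Measure V)) :
    Lp ℂ 2 (volume : Measure V) :=
  Lp.compMeasurePreserving (· + h) (measurePreserving_add_right volume h) U

theorem coeFn_translate (h : V) (U : Lp ℂ 2 (volume : Measure V)) :
    translate h U =ᵐ[volume] fun x => U (x + h) :=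
  Lp.coeFn_compMeasurePreserving U (measurePreserving_add_right volume h)

theorem continuous_translate (h : V) : Continuous (translate h) :=
  (Lp.isometry_compMeasurePreserving (measurePreserving_add_right volume h)).continuous

/-- The Fourier transform turns a translation into the multiplication by a character. -/
theorem fourier_translate (h : V) (U : Lp ℂ 2 (volume : Measure V)) :
    (𝓕 (translate h U) : Lp ℂ 2 (volume : Measure V)) =
      ((memLp_phase h).toLp _ • (𝓕 U : Lp ℂ 2 (volume : Measure V)) :
        Lp ℂ 2 (volume : Measure V)) := by
  have hcont : Continuous fun W : Lp ℂ 2 (volume : Measure V) =>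
      ((memLp_phase h).toLp _ • W : Lp ℂ 2 (volume : Measure V)) :=
    ((ContinuousLinearMap.lsmul ℂ ℂ (E := ℂ)).holderL volume ∞ 2 2
      ((memLp_phase h).toLp _)).continuous
  have hF : Continuous fun W : Lp ℂ 2 (volume : Measure V) =>
    (𝓕 W : Lp ℂ 2 (volume : Measure V)) := ContinuousFourier.continuous_fourier
  refine DenseRange.induction_on (p := fun U : Lp ℂ 2 (volume : Measure V) =>
    (𝓕 (translate h U) : Lp ℂ 2 (volume : Measure V)) =
      ((memLp_phase h).toLp _ • (𝓕 U : Lp ℂ 2 (volume : Measure V)) :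
        Lp ℂ 2 (volume : Measure V)))
    (SchwartzMap.denseRange_toLpCLM (F := ℂ) (E := V) (μ := volume) (p := 2)
      ENNReal.ofNat_ne_top) U
    (isClosed_eq (hF.comp (continuous_translate h)) (hcont.comp hF)) fun φ => ?_
  have h1 : translate h (φ.toLp 2) = (φ.compSubConstCLM ℂ (-h)).toLp 2 := by
    refine Lp.ext ((coeFn_translate _ _).trans ?_)
    have := (measurePreserving_add_right volume h).quasiMeasurePreserving.ae_eq_comp
      (φ.coeFn_toLp 2 volume)
    refine Filter.EventuallyEq.trans this ?_
    refine Filter.EventuallyEq.trans ?_ ((φ.compSubConstCLM ℂ (-h)).coeFn_toLp 2 volume).symm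
    exact Filter.Eventually.of_forall fun x => by simp
  rw [SchwartzMap.toLpCLM_apply, h1, SchwartzMap.toLp_fourier_eq, SchwartzMap.toLp_fourier_eq]
  refine Lp.ext (((𝓕 (φ.compSubConstCLM ℂ (-h))).coeFn_toLp 2 volume).trans ?_)
  filter_upwards [Lp.coeFn_lpSMul (r := 2) ((memLp_phase h).toLp _) ((𝓕 φ).toLp 2 volume),
    (memLp_phase h).coeFn_toLp, (𝓕 φ).coeFn_toLp 2 volume] with ξ e1 e2 e3
  rw [e1, Pi.smul_apply', e2, e3, SchwartzMap.fourier_coe, SchwartzMap.fourier_coe]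
  have h2 : ((φ.compSubConstCLM ℂ (-h) : 𝓢(V, ℂ)) : V → ℂ) = φ ∘ fun v => v + h := by
    ext x; simp
  rw [h2]
  exact congrFun (VectorFourier.fourierIntegral_comp_add_right Real.fourierChar volume
    (innerₗ V) φ h) ξ

/-- Plancherel's formula for difference quotients. -/
theorem lintegral_enorm_translate_sub (h : V) (U : Lp ℂ 2 (volume : Measure V)) :
    ∫⁻ x, ‖U x - U (x + h)‖ₑ ^ 2 =
      ∫⁻ ξ, ‖phase h ξ - 1‖ₑ ^ 2 * ‖(𝓕 U : Lp ℂ 2 (volume : Measure V)) ξ‖ₑ ^ 2 := by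
  have h1 : ∫⁻ x, ‖U x - U (x + h)‖ₑ ^ 2 = ∫⁻ x, ‖(translate h U - U) x‖ₑ ^ 2 := by
    refine lintegral_congr_ae ?_
    filter_upwards [Lp.coeFn_sub (translate h U) U, coeFn_translate h U] with x e1 e2
    rw [e1, Pi.sub_apply, e2, ← neg_sub, enorm_neg]
  rw [h1, ← lintegral_enorm_fourier_sq]
  refine lintegral_congr_ae ?_
  have h2 : (𝓕 (translate h U - U) : Lp ℂ 2 (volume : Measure V)) =
      𝓕 (translate h U) - 𝓕 U := by
    exact map_sub (Lp.fourierTransformₗᵢ V ℂ) _ _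
  rw [h2, fourier_translate]
  filter_upwards [Lp.coeFn_sub ((memLp_phase h).toLp _ • (𝓕 U : Lp ℂ 2 (volume : Measure V)) :
        Lp ℂ 2 (volume : Measure V)) (𝓕 U),
    Lp.coeFn_lpSMul (r := 2) ((memLp_phase h).toLp _) (𝓕 U : Lp ℂ 2 (volume : Measure V)),
    (memLp_phase h).coeFn_toLp] with ξ e1 e2 e3
  rw [e1, Pi.sub_apply, e2, Pi.smul_apply', e3, ← mul_pow, ← enorm_mul]
  congr 2
  simp only [smul_eq_mul]
  ring

/-- The square of the Gagliardo seminorm, `∬ |u(x) - u(y)|² |x - y|^{-p} dx dy`; the seminorm of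
`H^α` is the case `p = dim V + 2α`. The value of `|x - y|^{-p}` on the diagonal is `∞` if `p > 0`,
and is multiplied by `0`. -/
noncomputable def gagliardo (p : ℝ) (u : V → ℂ) : ℝ≥0∞ :=
  ∫⁻ x, ∫⁻ y, ‖u x - u y‖ₑ ^ 2 * ‖x - y‖ₑ ^ (-p)

/-- The Fourier symbol `∫ |e^{2πi⟨h, ξ⟩} - 1|² |h|^{-p} dh` of the squared Gagliardo seminorm. -/
noncomputable def gagliardoSymbol (p : ℝ) (ξ : V) : ℝ≥0∞ :=
  ∫⁻ h : V, ‖phase h ξ - 1‖ₑ ^ 2 * ‖h‖ₑ ^ (-p)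

/-- The Gagliardo seminorm is a weighted `L²` norm of the Fourier transform, by Plancherel's formula
for the difference quotients and Tonelli's theorem. -/
theorem gagliardo_eq_lintegral_fourier (p : ℝ) (U : Lp ℂ 2 (volume : Measure V)) :
    gagliardo p U =
      ∫⁻ ξ, gagliardoSymbol p ξ * ‖(𝓕 U : Lp ℂ 2 (volume : Measure V)) ξ‖ₑ ^ 2 := by
  have hU : Measurable U := (Lp.stronglyMeasurable U).measurable
  have hFU : Measurable (𝓕 U : Lp ℂ 2 (volume : Measure V)) :=
    (Lp.stronglyMeasurable _).measurable
  calc gagliardo p U = ∫⁻ x, ∫⁻ h, ‖U x - U (x + h)‖ₑ ^ 2 * ‖h‖ₑ ^ (-p) := by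
        refine lintegral_congr fun x => ?_
        rw [← lintegral_add_left_eq_self _ x]
        simp
    _ = ∫⁻ h, ∫⁻ x, ‖U x - U (x + h)‖ₑ ^ 2 * ‖h‖ₑ ^ (-p) :=
        lintegral_lintegral_swap (by fun_prop)
    _ = ∫⁻ h, ∫⁻ ξ, ‖phase h ξ - 1‖ₑ ^ 2 * ‖h‖ₑ ^ (-p) *
          ‖(𝓕 U : Lp ℂ 2 (volume : Measure V)) ξ‖ₑ ^ 2 := by
        refine lintegral_congr fun h => ?_
        rw [lintegral_mul_const _ (by fun_prop), lintegral_enorm_translate_sub,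
          ← lintegral_mul_const]
        · simp only [mul_right_comm]
        · have := (continuous_phase.comp (Continuous.prodMk_right h)).measurable
          fun_prop
    _ = ∫⁻ ξ, ∫⁻ h, ‖phase h ξ - 1‖ₑ ^ 2 * ‖h‖ₑ ^ (-p) *
          ‖(𝓕 U : Lp ℂ 2 (volume : Measure V)) ξ‖ₑ ^ 2 := by
        refine lintegral_lintegral_swap ?_
        have := (continuous_phase (V := V)).measurable
        unfold Function.uncurry
        fun_prop
    _ = _ := by
        refine lintegral_congr fun ξ => ?_
        rw [lintegral_mul_const, gagliardoSymbol]
        have := (continuous_phase.comp (Continuous.prodMk_left ξ)).measurable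
        fun_prop

end Gagliardo

/-! ### The symbol of the Gagliardo seminorm -/

section Symbol

open FourierTransform Module
open scoped ENNReal

variable {V : Type*} [NormedAddCommGroup V] [InnerProductSpace ℝ V] [FiniteDimensional ℝ V]
  [MeasurableSpace V] [BorelSpace V]

theorem gagliardoSymbol_isometry (p : ℝ) (e : V ≃ₗᵢ[ℝ] V) (ξ : V) :
    gagliardoSymbol p (e ξ) = gagliardoSymbol p ξ := by
  rw [gagliardoSymbol, ← e.measurePreserving.lintegral_comp_emb
    e.toHomeomorph.measurableEmbedding, gagliardoSymbol]
  refine lintegral_congr fun h => ?_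
  rw [phase, phase, e.inner_map_map, ← ofReal_norm (e h), e.norm_map, ofReal_norm]

/-- Homogeneity of the symbol, by the substitution `h ↦ r h`. -/
theorem gagliardoSymbol_smul (p : ℝ) {r : ℝ} (hr : 0 < r) (ξ : V) :
    gagliardoSymbol p (r • ξ) = ‖r‖ₑ ^ (p - finrank ℝ V) * gagliardoSymbol p ξ := by
  have hr0 : ‖r‖ₑ ≠ 0 := by simpa using hr.ne'
  have hrt : ‖r‖ₑ ≠ ⊤ := enorm_ne_top
  have hm : Measurable fun h : V => ‖phase h ξ - 1‖ₑ ^ 2 * ‖h‖ₑ ^ (-p) := by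
    have := ((continuous_phase (V := V)).comp (Continuous.prodMk_left ξ)).measurable
    fun_prop
  calc gagliardoSymbol p (r • ξ)
      = ∫⁻ h : V, ‖r‖ₑ ^ p * (‖phase (r • h) ξ - 1‖ₑ ^ 2 * ‖r • h‖ₑ ^ (-p)) := by
        refine lintegral_congr fun h => ?_
        rw [enorm_smul, ENNReal.mul_rpow_of_ne_top hrt enorm_ne_top, mul_left_comm,
          ← mul_assoc (‖r‖ₑ ^ p), ← ENNReal.rpow_add _ _ hr0 hrt, add_neg_cancel,
          ENNReal.rpow_zero, one_mul, phase, phase, inner_smul_left, inner_smul_right]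
        simp
    _ = ‖r‖ₑ ^ p * ∫⁻ h : V, (‖phase (r • h) ξ - 1‖ₑ ^ 2 * ‖r • h‖ₑ ^ (-p)) :=
        lintegral_const_mul _ (hm.comp (measurable_const_smul r))
    _ = ‖r‖ₑ ^ p * (‖r‖ₑ ^ (-(finrank ℝ V : ℝ)) * gagliardoSymbol p ξ) := by
        rw [← lintegral_map (f := fun h => ‖phase h ξ - 1‖ₑ ^ 2 * ‖h‖ₑ ^ (-p)) hm
          (measurable_const_smul r), Measure.map_addHaar_smul volume hr.ne',
          lintegral_smul_measure, gagliardoSymbol, smul_eq_mul]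
        congr 2
        rw [← Real.enorm_eq_ofReal_abs, enorm_inv (by positivity), enorm_pow, ENNReal.rpow_neg,
          ENNReal.rpow_natCast]
    _ = _ := by rw [← mul_assoc, ← ENNReal.rpow_add _ _ hr0 hrt, sub_eq_add_neg]

/-- A radial majorant of the integrand of the Gagliardo symbol at a unit vector. -/
theorem integrable_radial_majorant [Nontrivial V] {α : ℝ} (hα : α ∈ Set.Ioo (0 : ℝ) 1) :
    Integrable (fun h : V => (min 2 (2 * Real.pi * ‖h‖)) ^ 2 *
      ‖h‖ ^ (-(finrank ℝ V + 2 * α))) volume := by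
  have hd : 0 < finrank ℝ V := finrank_pos
  refine (integrable_fun_norm_addHaar (F := ℝ) volume
    (f := fun y => (min 2 (2 * Real.pi * y)) ^ 2 * y ^ (-(finrank ℝ V + 2 * α)))).2 ?_
  have hpow : ∀ y : ℝ, 0 < y → y ^ (finrank ℝ V - 1) * y ^ (-(finrank ℝ V + 2 * α)) =
      y ^ (-1 - 2 * α) := fun y hy => by
    rw [← Real.rpow_natCast, ← Real.rpow_add hy, Nat.cast_sub hd]
    congr 1
    push_cast
    ring
  have hmeas : Measurable fun y : ℝ => y ^ (finrank ℝ V - 1) •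
      ((min 2 (2 * Real.pi * y)) ^ 2 * y ^ (-(finrank ℝ V + 2 * α))) := by fun_prop
  have hsplit : Set.Ioi (0 : ℝ) = Set.Ioo 0 1 ∪ Set.Ici 1 := by
    rw [Set.Ioo_union_Ici_eq_Ioi zero_lt_one]
  rw [hsplit, integrableOn_union, integrableOn_Ici_iff_integrableOn_Ioi]
  constructor
  · refine Integrable.mono' (((intervalIntegral.integrableOn_Ioo_rpow_iff zero_lt_one).2
      (by linarith [hα.2] : -1 < 1 - 2 * α)).const_mul ((2 * Real.pi) ^ 2))
      hmeas.aestronglyMeasurable ?_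
    filter_upwards [ae_restrict_mem measurableSet_Ioo] with y hy
    have hy0 := hy.1
    have h0 : 0 ≤ min 2 (2 * Real.pi * y) := by positivity
    rw [Real.norm_of_nonneg (by positivity), smul_eq_mul, mul_left_comm, hpow y hy0]
    -- near `0` the factor `|h|²` lowers the singularity to `y ^ (1 - 2α)`
    have h2 : y ^ (1 - 2 * α) = y ^ 2 * y ^ (-1 - 2 * α) := by
      rw [← Real.rpow_natCast, ← Real.rpow_add hy0]
      congr 1
      push_cast
      ring
    rw [h2, ← mul_assoc, ← mul_pow]
    gcongr
    exact min_le_right _ _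
  · refine Integrable.mono' (((integrableOn_Ioi_rpow_iff zero_lt_one).2
      (by linarith [hα.1] : -1 - 2 * α < -1)).const_mul (2 ^ 2))
      hmeas.aestronglyMeasurable ?_
    filter_upwards [ae_restrict_mem measurableSet_Ioi] with y hy
    have hy0 : 0 < y := zero_lt_one.trans hy
    have h0 : 0 ≤ min 2 (2 * Real.pi * y) := by positivity
    rw [Real.norm_of_nonneg (by positivity), smul_eq_mul, mul_left_comm, hpow y hy0]
    gcongr
    exact min_le_left _ _

theorem gagliardoSymbol_lt_top [Nontrivial V] {α : ℝ} (hα : α ∈ Set.Ioo (0 : ℝ) 1) {e : V}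
    (he : ‖e‖ = 1) : gagliardoSymbol (finrank ℝ V + 2 * α) e < ⊤ := by
  refine lt_of_le_of_lt ?_ (integrable_radial_majorant (V := V) hα).lintegral_lt_top
  refine lintegral_mono_ae ?_
  filter_upwards [Measure.ae_ne volume (0 : V)] with h hh
  have hpos : 0 < ‖h‖ := norm_pos_iff.2 hh
  rw [ENNReal.ofReal_mul (by positivity), ← ENNReal.ofReal_rpow_of_pos hpos, ofReal_norm,
    ENNReal.ofReal_pow (by positivity), ← ofReal_norm (phase h e - 1)]
  gcongr
  refine le_min (norm_phase_sub_one_le_two h e) ?_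
  simpa [he] using norm_phase_sub_one_le h e

theorem gagliardoSymbol_ne_zero (p : ℝ) {e : V} (he : ‖e‖ = 1) : gagliardoSymbol p e ≠ 0 := by
  intro h0
  have hc : Continuous fun h : V => phase h e :=
    continuous_phase.comp (Continuous.prodMk_left e)
  rw [gagliardoSymbol, lintegral_eq_zero_iff (by have := hc.measurable; fun_prop)] at h0
  have hopen : IsOpen {h : V | phase h e ≠ 1} := isOpen_ne_fun hc continuous_const
  -- the character takes the value `-1` at `e / 2`
  have hmem : (1 / 2 : ℝ) • e ∈ {h : V | phase h e ≠ 1} := by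
    have : phase ((1 / 2 : ℝ) • e) e = -1 := by
      rw [phase, inner_smul_left, real_inner_self_eq_norm_sq, he, Real.fourierChar_apply]
      rw [← Complex.exp_pi_mul_I]
      congr 1
      push_cast
      simp
      ring
    simp only [Set.mem_ofPred_eq, this]
    norm_num
  have hpos := hopen.measure_pos (volume : Measure V) ⟨_, hmem⟩
  refine hpos.ne' (measure_mono_null (fun h hh => ?_) h0)
  simp only [Set.mem_ofPred_eq] at hh
  have h1 : ‖phase h e - 1‖ₑ ^ 2 ≠ 0 := by
    simpa [sub_eq_zero] using hh
  have hh0 : h ≠ 0 := fun h0' => hh (by simp [h0', phase])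
  have h2 : ‖h‖ₑ ^ (-p) ≠ 0 :=
    (ENNReal.rpow_pos (enorm_pos.2 hh0) enorm_ne_top).ne'
  exact mul_ne_zero h1 h2

/-- The symbol of the Gagliardo seminorm is a multiple of `|ξ|^{2α}`: it is homogeneous of degree
`2α` and invariant under rotations. -/
theorem exists_gagliardoSymbol_eq [Nontrivial V] {α : ℝ} (hα : α ∈ Set.Ioo (0 : ℝ) 1) :
    ∃ c : ℝ≥0∞, c ≠ 0 ∧ c ≠ ⊤ ∧
      ∀ ξ : V, gagliardoSymbol (finrank ℝ V + 2 * α) ξ = c * ‖ξ‖ₑ ^ (2 * α) := by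
  obtain ⟨e, he⟩ := exists_norm_eq V zero_le_one
  refine ⟨_, gagliardoSymbol_ne_zero _ he, (gagliardoSymbol_lt_top hα he).ne, fun ξ => ?_⟩
  rcases eq_or_ne ξ 0 with rfl | hξ
  · have : (0 : ℝ) < 2 * α := by linarith [hα.1]
    simp [gagliardoSymbol, phase_zero_right, this]
  · have hpos : 0 < ‖ξ‖ := norm_pos_iff.2 hξ
    -- a reflection maps `e` to the unit vector in the direction of `ξ`
    have h1 : ‖e‖ = ‖‖ξ‖⁻¹ • ξ‖ := by
      rw [norm_smul, norm_inv, norm_norm, inv_mul_cancel₀ hpos.ne', he]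
    have h2 := gagliardoSymbol_isometry (finrank ℝ V + 2 * α)
      ((ℝ ∙ (e - ‖ξ‖⁻¹ • ξ))ᗮ.reflection) e
    rw [Submodule.reflection_sub h1] at h2
    have h3 := gagliardoSymbol_smul (finrank ℝ V + 2 * α) hpos (‖ξ‖⁻¹ • ξ)
    rw [smul_smul, mul_inv_cancel₀ hpos.ne', one_smul, h2, enorm_norm, add_sub_cancel_left] at h3
    rw [h3, mul_comm]

end Symbol

/-! ### Sobolev spaces and the Gagliardo seminorm -/

section SobolevFourier

open FourierTransform Module TemperedDistribution
open scoped ENNReal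

variable {V : Type*} [NormedAddCommGroup V]

/-- The symbol `(1 + |ξ|²)^{s/2}` of the Bessel potential. -/
noncomputable def besselSymbol (s : ℝ) (ξ : V) : ℂ := ((1 + ‖ξ‖ ^ 2) ^ (s / 2) : ℝ)

theorem besselSymbol_mul_neg (s : ℝ) : (besselSymbol s : V → ℂ) * besselSymbol (-s) = 1 := by
  ext ξ
  have : (0 : ℝ) < 1 + ‖ξ‖ ^ 2 := by positivity
  rw [Pi.mul_apply, besselSymbol, besselSymbol, ← Complex.ofReal_mul, ← Real.rpow_add this]
  simp [neg_div]

theorem enorm_besselSymbol_sq (s : ℝ) (ξ : V) :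
    ‖besselSymbol s ξ‖ₑ ^ 2 = (1 + ‖ξ‖ₑ ^ 2) ^ s := by
  have : (0 : ℝ) < 1 + ‖ξ‖ ^ 2 := by positivity
  rw [← ofReal_norm, besselSymbol, Complex.norm_real, Real.norm_of_nonneg (by positivity),
    ← ENNReal.ofReal_pow (by positivity), ← Real.rpow_natCast, ← Real.rpow_mul this.le,
    ← ENNReal.ofReal_rpow_of_pos this, ENNReal.ofReal_add zero_le_one (by positivity),
    ENNReal.ofReal_one, ENNReal.ofReal_pow (norm_nonneg _), ofReal_norm]
  congr 1
  push_cast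
  ring

variable [InnerProductSpace ℝ V]

theorem besselSymbol_hasTemperateGrowth (s : ℝ) :
    (besselSymbol s : V → ℂ).HasTemperateGrowth := by
  unfold besselSymbol
  fun_prop

variable [FiniteDimensional ℝ V] [MeasurableSpace V] [BorelSpace V]

theorem memLp_besselSymbol_neg {s : ℝ} (hs : 0 ≤ s) :
    MemLp (besselSymbol (-s) : V → ℂ) ⊤ volume := by
  refine memLp_top_of_bound
    (besselSymbol_hasTemperateGrowth _).1.continuous.aestronglyMeasurable 1
    (Filter.Eventually.of_forall fun ξ => ?_)
  rw [besselSymbol, Complex.norm_real, Real.norm_of_nonneg (by positivity)]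
  refine Real.rpow_le_one_of_one_le_of_nonpos ?_ (by linarith)
  have : 0 ≤ ‖ξ‖ ^ 2 := by positivity
  linarith

theorem toTemperedDistribution_injective {f g : Lp ℂ 2 (volume : Measure V)}
    (h : (f : 𝓢'(V, ℂ)) = g) : f = g :=
  LinearMap.ker_eq_bot.1 (Lp.ker_toTemperedDistributionCLM_eq_bot (E := V) (F := ℂ) (p := 2)
    (μ := volume)) h

/-- For `L²` functions, membership in `H^α` in terms of the homogeneous Fourier weight. -/
theorem memSobolev_iff_lintegral {α : ℝ} (hα : α ∈ Set.Ioo (0 : ℝ) 1)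
    (U : Lp ℂ 2 (volume : Measure V)) :
    MemSobolev α 2 (U : 𝓢'(V, ℂ)) ↔
      ∫⁻ ξ, ‖ξ‖ₑ ^ (2 * α) * ‖(𝓕 U : Lp ℂ 2 (volume : Measure V)) ξ‖ₑ ^ 2 < ⊤ := by
  have hrpow : ∀ ξ : V, ‖ξ‖ₑ ^ (2 * α) = (‖ξ‖ₑ ^ 2) ^ α := fun ξ => by
    rw [← ENNReal.rpow_natCast, ← ENNReal.rpow_mul]
    rfl
  have hgrow := besselSymbol_hasTemperateGrowth (V := V) α
  have hgrow' := besselSymbol_hasTemperateGrowth (V := V) (-α)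
  have hone : ∀ T : 𝓢'(V, ℂ), smulLeftCLM ℂ (1 : V → ℂ) T = T := fun T => by
    have := smulLeftCLM_const (E := V) (F := ℂ) 1 T
    rw [one_smul] at this
    exact this
  have hbd := memLp_besselSymbol_neg (V := V) hα.1.le
  rw [memSobolev_iff_exists_smulLeftCLM_fourier, Lp.fourier_toTemperedDistribution_eq]
  set w : Lp ℂ 2 (volume : Measure V) := 𝓕 U
  change (∃ f' : Lp ℂ 2 (volume : Measure V), smulLeftCLM ℂ (besselSymbol α) (w : 𝓢'(V, ℂ)) = f')
    ↔ _
  -- `f'` is the product of the symbol with `𝓕 U`; the bounded symbol of order `-α` recovers `𝓕 U`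
  constructor
  · rintro ⟨f', hf'⟩
    have h1 : ((hbd.toLp _ • f' : Lp ℂ 2 (volume : Measure V)) : 𝓢'(V, ℂ)) = w := by
      rw [Lp.toTemperedDistribution_smul_eq hgrow' hbd, ← hf',
        smulLeftCLM_smulLeftCLM_apply hgrow hgrow', besselSymbol_mul_neg, hone]
    have h2 := toTemperedDistribution_injective h1
    have h3 : ∫⁻ ξ, ‖f' ξ‖ₑ ^ 2 < ⊤ := by
      rw [lintegral_enorm_sq]
      exact ENNReal.pow_lt_top enorm_lt_top
    refine lt_of_le_of_lt (lintegral_mono_ae ?_) h3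
    filter_upwards [Lp.coeFn_lpSMul (r := 2) (hbd.toLp _) f', hbd.coeFn_toLp] with ξ e1 e2
    rw [← h2, e1, Pi.smul_apply', e2, smul_eq_mul, enorm_mul, mul_pow, enorm_besselSymbol_sq,
      hrpow, ← mul_assoc]
    refine mul_le_of_le_one_left' ?_
    rw [ENNReal.rpow_neg]
    refine ENNReal.div_le_of_le_mul ?_
    rw [one_mul]
    exact ENNReal.rpow_le_rpow le_add_self hα.1.le
  · intro hfin
    have hmeas : AEStronglyMeasurable (fun ξ => besselSymbol α ξ * w ξ) volume :=
      hgrow.1.continuous.aestronglyMeasurable.mul (Lp.aestronglyMeasurable w)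
    have hL : MemLp (fun ξ => besselSymbol α ξ * w ξ) 2 volume := by
      refine ⟨hmeas, ?_⟩
      rw [eLpNorm_lt_top_iff_lintegral_rpow_enorm_lt_top (by simp) (by simp)]
      have hw : ∫⁻ ξ, ‖w ξ‖ₑ ^ 2 < ⊤ := by
        rw [lintegral_enorm_sq]
        exact ENNReal.pow_lt_top enorm_lt_top
      refine lt_of_le_of_lt (lintegral_mono (g := fun ξ => ‖w ξ‖ₑ ^ 2 +
        ‖ξ‖ₑ ^ (2 * α) * ‖w ξ‖ₑ ^ 2) fun ξ => ?_) ?_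
      · simp only [ENNReal.toReal_ofNat, ENNReal.rpow_ofNat]
        rw [enorm_mul, mul_pow, enorm_besselSymbol_sq, hrpow]
        calc (1 + ‖ξ‖ₑ ^ 2) ^ α * ‖w ξ‖ₑ ^ 2
            ≤ (1 ^ α + (‖ξ‖ₑ ^ 2) ^ α) * ‖w ξ‖ₑ ^ 2 := by
              gcongr
              exact ENNReal.rpow_add_le_add_rpow _ _ hα.1.le hα.2.le
          _ = _ := by rw [ENNReal.one_rpow, add_mul, one_mul]
      · rw [lintegral_add_left ((Lp.stronglyMeasurable w).enorm.pow_const 2)]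
        exact ENNReal.add_lt_top.2 ⟨hw, hfin⟩
    refine ⟨hL.toLp _, ?_⟩
    have h1 : (hbd.toLp _ • hL.toLp _ : Lp ℂ 2 (volume : Measure V)) = w := by
      refine Lp.ext ?_
      filter_upwards [Lp.coeFn_lpSMul (r := 2) (hbd.toLp _) (hL.toLp _), hbd.coeFn_toLp,
        hL.coeFn_toLp] with ξ e1 e2 e3
      have := congrFun (besselSymbol_mul_neg (V := V) α) ξ
      simp only [Pi.mul_apply, Pi.one_apply] at this
      rw [e1, Pi.smul_apply', e2, e3, smul_eq_mul, ← mul_assoc, mul_comm (besselSymbol (-α) ξ),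
        this, one_mul]
    have h2 : (w : 𝓢'(V, ℂ)) = smulLeftCLM ℂ (besselSymbol (-α)) (hL.toLp _ : 𝓢'(V, ℂ)) := by
      rw [← Lp.toTemperedDistribution_smul_eq (r := 2) hgrow' hbd, h1]
    rw [h2, smulLeftCLM_smulLeftCLM_apply hgrow' hgrow, mul_comm, besselSymbol_mul_neg, hone]

/-- An `L²` function belongs to `H^α`, `0 < α < 1`, if and only if its Gagliardo seminorm is
finite. -/
theorem memSobolev_iff_gagliardo [Nontrivial V] {α : ℝ} (hα : α ∈ Set.Ioo (0 : ℝ) 1)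
    (U : Lp ℂ 2 (volume : Measure V)) :
    MemSobolev α 2 (U : 𝓢'(V, ℂ)) ↔ gagliardo (finrank ℝ V + 2 * α) U < ⊤ := by
  obtain ⟨c, hc0, hc, h⟩ := exists_gagliardoSymbol_eq (V := V) hα
  rw [memSobolev_iff_lintegral hα, gagliardo_eq_lintegral_fourier]
  simp only [h, mul_assoc]
  rw [lintegral_const_mul' _ _ hc, ENNReal.mul_lt_top_iff]
  simp [hc0, hc.lt_top]
  intro h0
  simp [h0]

/-! ### Composition of Sobolev functions with Lipschitz maps -/

theorem gagliardo_congr_ae {p : ℝ} {u v : V → ℂ} (h : u =ᵐ[volume] v) :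
    gagliardo p u = gagliardo p v := by
  refine lintegral_congr_ae ?_
  filter_upwards [h] with x hx
  refine lintegral_congr_ae ?_
  filter_upwards [h] with y hy
  rw [hx, hy]

/-- Since `|Φ(x) - Φ(y)| ≤ L |x - y|`, the kernel increases by the factor `L ^ p` at most; each of
the two changes of variables costs a factor `C`. -/
theorem gagliardo_comp_lt_top {p : ℝ} (hp : 0 ≤ p) {u : V → ℂ} (hu : Measurable u) {Φ : V → V}
    (hm : Measurable Φ) {L : NNReal} (hL0 : L ≠ 0) (hL : LipschitzWith L Φ) {C : ℝ≥0∞} (hC : C ≠ ⊤)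
    (hmap : Measure.map Φ volume ≤ C • volume) (hfin : gagliardo p u < ⊤) :
    gagliardo p (u ∘ Φ) < ⊤ := by
  have hchange : ∀ f : V → ℝ≥0∞, Measurable f → ∫⁻ x, f (Φ x) ≤ C * ∫⁻ x, f x := fun f hf => by
    rw [← lintegral_map hf hm, ← smul_eq_mul, ← lintegral_smul_measure]
    exact lintegral_mono' hmap le_rfl
  have hF : Measurable fun q : V × V => ‖u q.1 - u q.2‖ₑ ^ 2 * ‖q.1 - q.2‖ₑ ^ (-p) := by
    fun_prop
  have hLt : (L : ℝ≥0∞) ^ p ≠ ⊤ := ENNReal.rpow_ne_top_of_nonneg hp ENNReal.coe_ne_top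
  have hL0' : (L : ℝ≥0∞) ^ p ≠ 0 :=
    (ENNReal.rpow_pos (by simpa using hL0.bot_lt) ENNReal.coe_ne_top).ne'
  have hkey : ∀ x y, ‖x - y‖ₑ ^ (-p) ≤ (L : ℝ≥0∞) ^ p * ‖Φ x - Φ y‖ₑ ^ (-p) := fun x y => by
    have h1 : ‖Φ x - Φ y‖ₑ ^ p ≤ (L : ℝ≥0∞) ^ p * ‖x - y‖ₑ ^ p := by
      rw [← ENNReal.mul_rpow_of_nonneg _ _ hp, ← edist_eq_enorm_sub, ← edist_eq_enorm_sub]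
      exact ENNReal.rpow_le_rpow (hL x y) hp
    calc ‖x - y‖ₑ ^ (-p) = (L : ℝ≥0∞) ^ p * ((L : ℝ≥0∞) ^ p * ‖x - y‖ₑ ^ p)⁻¹ := by
          rw [ENNReal.mul_inv (Or.inl hL0') (Or.inl hLt), ← mul_assoc,
            ENNReal.mul_inv_cancel hL0' hLt, one_mul, ENNReal.rpow_neg]
      _ ≤ _ := by
          rw [ENNReal.rpow_neg]
          gcongr
  calc gagliardo p (u ∘ Φ)
      ≤ ∫⁻ x, ∫⁻ y, (L : ℝ≥0∞) ^ p * (‖u (Φ x) - u (Φ y)‖ₑ ^ 2 * ‖Φ x - Φ y‖ₑ ^ (-p)) := by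
        refine lintegral_mono fun x => lintegral_mono fun y => ?_
        simp only [Function.comp_apply]
        rw [mul_left_comm]
        gcongr
        exact hkey x y
    _ ≤ ∫⁻ x, (L : ℝ≥0∞) ^ p * (C * ∫⁻ y, ‖u (Φ x) - u y‖ₑ ^ 2 * ‖Φ x - y‖ₑ ^ (-p)) := by
        refine lintegral_mono fun x => ?_
        rw [lintegral_const_mul' _ _ hLt]
        gcongr
        exact hchange (fun y => ‖u (Φ x) - u y‖ₑ ^ 2 * ‖Φ x - y‖ₑ ^ (-p)) (by fun_prop)
    _ ≤ (L : ℝ≥0∞) ^ p * (C * (C * gagliardo p u)) := by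
        rw [lintegral_const_mul' _ _ hLt, lintegral_const_mul' _ _ hC]
        gcongr
        exact hchange (fun x => ∫⁻ y, ‖u x - u y‖ₑ ^ 2 * ‖x - y‖ₑ ^ (-p))
          hF.lintegral_prod_right'
    _ < ⊤ := ENNReal.mul_lt_top hLt.lt_top
        (ENNReal.mul_lt_top hC.lt_top (ENNReal.mul_lt_top hC.lt_top hfin))

/-- Composition with a Lipschitz map preserves `H^α`, `0 < α < 1`, if preimages of sets have at most
a constant multiple of their volume. -/
theorem memSobolev_comp [Nontrivial V] {α : ℝ} (hα : α ∈ Set.Ioo (0 : ℝ) 1) {Φ : V → V}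
    (hm : Measurable Φ) {L : NNReal} (hL0 : L ≠ 0) (hL : LipschitzWith L Φ) {C : ℝ≥0∞} (hC : C ≠ ⊤)
    (hmap : Measure.map Φ volume ≤ C • volume) {U : Lp ℂ 2 (volume : Measure V)}
    (hU : MemSobolev α 2 (U : 𝓢'(V, ℂ))) :
    ∃ U' : Lp ℂ 2 (volume : Measure V), U' =ᵐ[volume] U ∘ Φ ∧
      MemSobolev α 2 (U' : 𝓢'(V, ℂ)) := by
  have hL2 : MemLp (U ∘ Φ) 2 volume :=
    ((Lp.memLp U).of_measure_le_smul hC hmap).comp_of_map hm.aemeasurable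
  refine ⟨hL2.toLp _, hL2.coeFn_toLp, ?_⟩
  rw [memSobolev_iff_gagliardo hα] at hU ⊢
  rw [gagliardo_congr_ae hL2.coeFn_toLp]
  have hp : (0 : ℝ) ≤ finrank ℝ V + 2 * α := by
    have := hα.1
    positivity
  exact gagliardo_comp_lt_top hp (Lp.stronglyMeasurable U).measurable hm hL0 hL hC hmap hU

end SobolevFourier

/-! ### Diffeomorphisms fixing the exterior -/

/-- A domain with smooth boundary is the interior of its closure: otherwise the defining function
would be nonpositive near some boundary point and hence have a critical point there. -/
theorem HasSmoothBoundary.interior_closure {Ω : Opens (Rn n)} (h : HasSmoothBoundary Ω) :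
    interior (closure (Ω : Set (Rn n))) ⊆ Ω := by
  intro p hp
  by_contra hpΩ
  have hfr : p ∈ frontier (Ω : Set (Rn n)) := by
    rw [Ω.isOpen.frontier_eq]
    exact ⟨interior_subset hp, hpΩ⟩
  obtain ⟨U, hU, hpU, ρ, hρ, hdρ, hΩ⟩ := h p hfr
  obtain ⟨v, hv⟩ : ∃ v, 0 < fderiv ℝ ρ p v := by
    by_contra! hle
    refine hdρ (ContinuousLinearMap.ext fun v => le_antisymm (hle v) ?_)
    have := hle (-v)
    simpa using this
  set V := U ∩ interior (closure (Ω : Set (Rn n))) with hV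
  have hVo : IsOpen V := hU.inter isOpen_interior
  -- in a neighbourhood of `p` the defining function is nonpositive, by density of `Ω`
  have hle : ∀ x ∈ V, ρ x ≤ 0 := by
    intro x hx
    by_contra! hpos
    have hc : ContinuousAt ρ x := hρ.continuousOn.continuousAt (hU.mem_nhds hx.1)
    have hev : ∀ᶠ y in nhds x, 0 < ρ y ∧ y ∈ U :=
      (hc.eventually (lt_mem_nhds hpos)).and (hU.mem_nhds hx.1)
    obtain ⟨y, hy, hyΩ⟩ := mem_closure_iff_nhds.1 (interior_subset hx.2) _ hev
    exact absurd ((hΩ y hy.2).1 hyΩ) (not_lt.2 hy.1.le)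
  have hp0 : 0 ≤ ρ p := not_lt.1 fun hlt => hpΩ ((hΩ p hpU).2 hlt)
  -- so `p` is a local maximum, which contradicts the nonvanishing of the differential
  have hmax : IsLocalMax ρ p := by
    filter_upwards [hVo.mem_nhds ⟨hpU, hp⟩] with x hx
    exact (hle x hx).trans hp0
  exact hdρ hmax.fderiv_eq_zero

section Fix

variable {Ω : Opens (Rn n)} {Φ : Diffeo n} (hfix : ∀ x ∈ exterior Ω, Φ x = x)
include hfix

theorem symm_fix : ∀ x ∈ exterior Ω, Φ.symm x = x := fun x hx => by
  conv_lhs => rw [← hfix x hx]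
  simp

theorem map_mem_exterior_iff (x : Rn n) : Φ x ∈ exterior Ω ↔ x ∈ exterior Ω := by
  refine ⟨fun hx => ?_, fun hx => by rwa [hfix x hx]⟩
  have := hfix _ hx
  rwa [Φ.injective this] at hx

/-- `Φ` maps `Ω` into itself: `Φ(Ω)` is open and contained in the closure of `Ω`. The boundary
regularity is needed here, since `Ω` has to be the interior of its closure. -/
theorem map_mem_domain (hΩ : HasSmoothBoundary Ω) {x : Rn n} (hx : x ∈ Ω) : Φ x ∈ Ω := by
  refine hΩ.interior_closure (interior_maximal ?_ (Φ.toHomeomorph.isOpenMap _ Ω.isOpen)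
    (Set.mem_image_of_mem Φ hx))
  rintro _ ⟨y, hy, rfl⟩
  by_contra hc
  exact (map_mem_exterior_iff hfix y).1 hc (subset_closure hy)

/-- A function that vanishes outside the exterior domain is unchanged by composition with `Φ`. -/
theorem comp_eq_of_support {β : Type*} [Zero β] {f : Rn n → β}
    (hf : ∀ x ∉ exterior Ω, f x = 0) : f ∘ Φ = f := by
  ext1 x
  by_cases hx : x ∈ exterior Ω
  · simp [hfix x hx]
  · rw [hf x hx, Function.comp_apply, hf _ (mt (map_mem_exterior_iff hfix x).1 hx)]

theorem fderiv_eq_id {x : Rn n} (hx : x ∈ exterior Ω) :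
    fderiv ℝ Φ x = ContinuousLinearMap.id ℝ (Rn n) := by
  have ho : IsOpen (exterior Ω) := isClosed_closure.isOpen_compl
  have : Φ =ᶠ[nhds x] id := by
    filter_upwards [ho.mem_nhds hx] with y hy using hfix y hy
  rw [this.fderiv_eq, fderiv_id]

theorem sqrtDet_eq_of_mem_exterior {g₁ g₂ : RiemannianMetric n} (h : IsPullback g₁ g₂ Φ)
    {x : Rn n} (hx : x ∈ exterior Ω) : g₁.sqrtDet x = g₂.sqrtDet x := by
  rw [h.sqrtDet_eq, fderiv_eq_id hfix hx, hfix x hx]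
  simp [ContinuousLinearMap.det]

end Fix

theorem testFunction_eq_zero {F : Type*} [NormedAddCommGroup F] [NormedSpace ℝ F]
    {Ω W : Opens (Rn n)} (hW : (W : Set (Rn n)) ⊆ exterior Ω)
    (φ : 𝓓(W, F)) (x : Rn n) (hx : x ∉ exterior Ω) : φ x = 0 :=
  image_eq_zero_of_notMem_tsupport fun hs => hx (hW (φ.tsupport_subset hs))

/-- A diffeomorphism that fixes the complement of a bounded set is Lipschitz. -/
theorem exists_lipschitzWith {Ω : Opens (Rn n)}
    (hΩb : Bornology.IsBounded (Ω : Set (Rn n))) {Φ : Diffeo n}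
    (hfix : ∀ x ∈ exterior Ω, Φ x = x) : ∃ L : NNReal, L ≠ 0 ∧ LipschitzWith L Φ := by
  have hc : HasCompactSupport fun x => Φ x - x :=
    HasCompactSupport.intro hΩb.isCompact_closure fun x hx => sub_eq_zero.2 (hfix x hx)
  obtain ⟨C, hC⟩ := ContDiff.lipschitzWith_of_hasCompactSupport (𝕂 := ℝ) (n := ∞) hc
    (Φ.contDiff.sub contDiff_id) (by simp)
  refine ⟨C + 1, by positivity, ?_⟩
  have h := hC.add LipschitzWith.id
  simpa using h

/-- A diffeomorphism that fixes the complement of a bounded set distorts the volume by at most a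
constant factor. -/
theorem exists_map_volume_le {Ω : Opens (Rn n)}
    (hΩb : Bornology.IsBounded (Ω : Set (Rn n))) {Φ : Diffeo n}
    (hfix : ∀ x ∈ exterior Ω, Φ x = x) :
    ∃ C : ENNReal, C ≠ ⊤ ∧ Measure.map Φ volume ≤ C • volume := by
  have hsymm := symm_fix hfix
  have hcont : Continuous fun x => (fderiv ℝ Φ.symm x).det - 1 :=
    (ContinuousLinearMap.continuous_det.comp
      (Φ.symm.contDiff.continuous_fderiv (by simp))).sub continuous_const
  have hc : HasCompactSupport fun x => (fderiv ℝ Φ.symm x).det - 1 := by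
    refine HasCompactSupport.intro hΩb.isCompact_closure fun x hx => ?_
    rw [fderiv_eq_id hsymm hx]
    simp [ContinuousLinearMap.det]
  obtain ⟨C, hC⟩ := hcont.bounded_above_of_compact_support hc
  refine ⟨ENNReal.ofReal (C + 1), ENNReal.ofReal_ne_top, Measure.le_iff.2 fun s hs => ?_⟩
  have hm : Measurable Φ := Φ.contDiff.continuous.measurable
  have himg : Φ ⁻¹' s = Φ.symm '' s := (Φ.toEquiv.image_symm_eq_preimage s).symm
  rw [Measure.map_apply hm hs, himg, ← lintegral_abs_det_fderiv_eq_addHaar_image volume hs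
    (fun x _ => (Diffeo.hasFDerivAt Φ.symm x).hasFDerivWithinAt) Φ.symm.injective.injOn,
    Measure.smul_apply, smul_eq_mul, ← setLIntegral_const]
  refine lintegral_mono fun x => ENNReal.ofReal_le_ofReal ?_
  have h1 := hC x
  rw [Real.norm_eq_abs] at h1
  have h2 := abs_add_le ((fderiv ℝ Φ.symm x).det - 1) 1
  rw [sub_add_cancel, abs_one] at h2
  linarith

theorem memHs_comp (hn : n ≠ 0) {α : ℝ} (hα : α ∈ Set.Ioo (0 : ℝ) 1) {Ω : Opens (Rn n)}
    (hΩb : Bornology.IsBounded (Ω : Set (Rn n))) {Φ : Diffeo n}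
    (hfix : ∀ x ∈ exterior Ω, Φ x = x) {u : Rn n → ℂ} (hu : MemHs α u) : MemHs α (u ∘ Φ) := by
  have : Nonempty (Fin n) := Fin.pos_iff_nonempty.1 (Nat.pos_of_ne_zero hn)
  obtain ⟨U, hUu, hU⟩ := hu
  obtain ⟨L, hL0, hL⟩ := exists_lipschitzWith hΩb hfix
  obtain ⟨C, hC, hmap⟩ := exists_map_volume_le hΩb hfix
  have hm : Measurable Φ := Φ.contDiff.continuous.measurable
  obtain ⟨U', hU', hS⟩ := memSobolev_comp hα hm hL0 hL hC hmap hU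
  have hq : Measure.QuasiMeasurePreserving Φ volume volume :=
    ⟨hm, (Measure.absolutelyContinuous_of_le_smul hmap)⟩
  exact ⟨U', hU'.trans (hq.ae_eq_comp hUu), hS⟩

/-- Composition with `Φ` carries the energy solution for `g₂` to the one for `g₁`: it preserves
`H^α` and the energy form, and it changes neither the exterior data nor the test functions on `W₂`.
The distribution on `W₂` is therefore the same for both metrics. -/
theorem dnMap_subset (hn : n ≠ 0) {α : ℝ} (hα : α ∈ Set.Ioo (0 : ℝ) 1) {g₁ g₂ : RiemannianMetric n}
    {Ω W₁ W₂ : Opens (Rn n)} (hΩb : Bornology.IsBounded (Ω : Set (Rn n)))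
    (hΩs : HasSmoothBoundary Ω) (hW₁ : (W₁ : Set (Rn n)) ⊆ exterior Ω)
    (hW₂ : (W₂ : Set (Rn n)) ⊆ exterior Ω) {Φ : Diffeo n} (h : IsPullback g₁ g₂ Φ)
    (hfix : ∀ x ∈ exterior Ω, Φ x = x) : dnMap α g₂ Ω W₁ W₂ ⊆ dnMap α g₁ Ω W₁ W₂ := by
  rintro ⟨f, w⟩ ⟨hw, u, hu, hr⟩
  have hf : (f : Rn n → ℂ) ∘ Φ = f := comp_eq_of_support hfix (testFunction_eq_zero hW₁ f)
  refine ⟨hw, u ∘ Φ, ⟨memHs_comp hn hα hΩb hfix hu.memHs, ?_, ?_, fun φ => ?_⟩, fun φ => ?_⟩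
  · have := memHs_comp hn hα hΩb hfix hu.sub_memHs
    rwa [show (u - (f : Rn n → ℂ)) ∘ Φ = u ∘ Φ - (f : Rn n → ℂ) ∘ Φ from rfl, hf] at this
  · filter_upwards [hu.exterior_eq] with x hx hxe
    rw [Function.comp_apply, hfix x hxe]
    exact hx hxe
  · have hm : ∀ x, Φ.symm x ∈ Ω → x ∈ Ω := fun x hx => by
      simpa using map_mem_domain hfix hΩs hx
    have key := h.hasEnergy_comp hα.1.le (hu.energy_eq (testComp Φ.symm hm φ))
    convert key using 1
    ext x
    change φ x = φ (Φ.symm (Φ x))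
    simp
  · have key := h.hasEnergy_comp hα.1.le (hr φ)
    convert key using 1
    have h0 := testFunction_eq_zero hW₂ φ
    rw [comp_eq_of_support hfix fun x hx => by simp [h0 x hx]]
    ext x
    by_cases hx : x ∈ exterior Ω
    · rw [sqrtDet_eq_of_mem_exterior hfix h hx]
    · simp [h0 x hx]

end FracCalderon

theorem propositionA1 {n : ℕ} (hn : 2 ≤ n) (α : ℝ) (hα : α ∈ Set.Ioo (0 : ℝ) 1)
    (g₁ g₂ : FracCalderon.RiemannianMetric n)
    (hg₁ : g₁.EuclideanOutsideCompact) (hg₂ : g₂.EuclideanOutsideCompact)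
    (Ω W₁ W₂ : Opens (FracCalderon.Rn n))
    (hΩb : Bornology.IsBounded (Ω : Set (FracCalderon.Rn n)))
    (hΩs : FracCalderon.HasSmoothBoundary Ω)
    (hW₁ : (W₁ : Set (FracCalderon.Rn n)) ⊆ FracCalderon.exterior Ω)
    (hW₁ne : (W₁ : Set (FracCalderon.Rn n)).Nonempty)
    (hW₂ : (W₂ : Set (FracCalderon.Rn n)) ⊆ FracCalderon.exterior Ω)
    (hW₂ne : (W₂ : Set (FracCalderon.Rn n)).Nonempty)
    (Φ : FracCalderon.Rn n ≃ₘ⟮𝓘(ℝ, FracCalderon.Rn n), 𝓘(ℝ, FracCalderon.Rn n)⟯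
      FracCalderon.Rn n)
    (hpull : ∀ x t s : FracCalderon.Rn n,
      g₁.form x t s = g₂.form (Φ x) (fderiv ℝ Φ x t) (fderiv ℝ Φ x s))
    (hfix : ∀ x ∈ FracCalderon.exterior Ω, Φ x = x) :
    FracCalderon.dnMap α g₁ Ω W₁ W₂ = FracCalderon.dnMap α g₂ Ω W₁ W₂ := by
  have h : FracCalderon.IsPullback g₁ g₂ Φ := hpull
  have hn0 : n ≠ 0 := by omega
  exact Set.Subset.antisymm
    (FracCalderon.dnMap_subset hn0 hα hΩb hΩs hW₁ hW₂ h.symm (FracCalderon.symm_fix hfix))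
    (FracCalderon.dnMap_subset hn0 hα hΩb hΩs hW₁ hW₂ h hfix)
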